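/- **Szemerédi's regularity lemma.** For a finite simple graph $H=(V,E)$ and nonempty $C,D\subseteq V$, let $e(C,D)$ be the number of pairs $(u,v)\in C\times D$ with $u,v$ adjacent, and let $d(C,D)=e(C,D)/(|C||D|)$. For $\varepsilon>0$, a partition $Q$ of $V$ into nonempty classes is called $\varepsilon$-balanced if there is a subcollection $Q'\subseteq Q$ with $|\bigcup Q'|\le\varepsilon|V|$ such that all classes in $Q\setminus Q'$ have the same cardinality. For each real $\varepsilon>0$ and each $p\in\mathbb{N}$ there exists $k_{p,\varepsilon}\in\mathbb{N}$ such that for each finite simple graph $H=(V,E)$ with $V\neq\emptyset$ and each partition $P$ of $V$ with $|P|=p$ there is an $\varepsilon$-balanced refinement $Q$ of $P$ with $|Q|\le k_{p,\varepsilon}$ and $$\sum_{A,B\in Q}\ \max_{\emptyset\ne C\subseteq A,\ \emptyset\ne D\subseteq B}|C||D|\cdot|d(C,D)-d(A,B)|\;<\;\varepsilon|V|^2,$$ where the sum is over all ordered pairs $(A,B)\in Q\times Q$, including $A=B$. -/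

import Mathlib

/-- A collection of finite sets is balanced if all its members have the same cardinality. -/
def IsBalanced {V : Type*} (P : Finset (Finset V)) : Prop :=
  ∀ A ∈ P, ∀ B ∈ P, A.card = B.card

/-- A partition `P` of the finite set `V` is `ε`-balanced if some subcollection `P'` of its classes
covers at most `ε |V|` elements and `P \ P'` is balanced. -/
def IsEpsBalanced {V : Type*} [Fintype V] [DecidableEq V] (ε : ℝ)
    (P : Finpartition (Finset.univ : Finset V)) : Prop :=
  ∃ P' ⊆ P.parts, IsBalanced (P.parts \ P') ∧
    ((P'.biUnion id).card : ℝ) ≤ ε * (Fintype.card V : ℝ)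

/-- `|C| |D| |d(C,D) - d(A,B)|`, where `d(C,D)` is the number of pairs in `C × D` that are adjacent
in `H`, divided by `|C| |D|`. -/
noncomputable def densityDeviation {V : Type*} (H : SimpleGraph V) [DecidableRel H.Adj]
    (A B C D : Finset V) : ℝ :=
  (C.card : ℝ) * (D.card : ℝ) * |(H.edgeDensity C D : ℝ) - (H.edgeDensity A B : ℝ)|

/-- The maximum of `|C| |D| |d(C,D) - d(A,B)|` over nonempty `C ⊆ A` and nonempty `D ⊆ B`.
It is attained when `A` and `B` are nonempty, see `isGreatest_maxDeviation`. -/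
noncomputable def maxDeviation {V : Type*} (H : SimpleGraph V) [DecidableRel H.Adj]
    (A B : Finset V) : ℝ :=
  sSup {x : ℝ | ∃ C D : Finset V, C.Nonempty ∧ C ⊆ A ∧ D.Nonempty ∧ D ⊆ B ∧
    x = densityDeviation H A B C D}

theorem isGreatest_maxDeviation {V : Type*} (H : SimpleGraph V) [DecidableRel H.Adj]
    {A B : Finset V} (hA : A.Nonempty) (hB : B.Nonempty) :
    IsGreatest {x : ℝ | ∃ C D : Finset V, C.Nonempty ∧ C ⊆ A ∧ D.Nonempty ∧ D ⊆ B ∧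
      x = densityDeviation H A B C D} (maxDeviation H A B) := by
  set S := {x : ℝ | ∃ C D : Finset V, C.Nonempty ∧ C ⊆ A ∧ D.Nonempty ∧ D ⊆ B ∧
      x = densityDeviation H A B C D} with hS
  have hfin : S.Finite := by
    refine (((A.powerset ×ˢ B.powerset).finite_toSet).image
      (fun p => densityDeviation H A B p.1 p.2)).subset ?_
    rintro x ⟨C, D, -, hC, -, hD, rfl⟩
    exact ⟨(C, D), by simp [hC, hD], rfl⟩
  have hne : S.Nonempty :=
    ⟨_, A, B, hA, Finset.Subset.refl _, hB, Finset.Subset.refl _, rfl⟩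
  exact ⟨hne.csSup_mem hfin, fun x hx => le_csSup hfin.bddAbove hx⟩

open Finset

/-! The argument is an energy increment. The step densities of a partition average the adjacency
function over its cells; their squares sum to an energy in [0, |V|²] that never falls under
refinement. If the maximal deviations of `Q` sum to at least ε|V|², cutting `Q` along extremal sets
C, D for all pairs of classes gains at least ε²|V|² (`exists_partitionEnergy_increment`). Balancing
is itself a refinement (`Finpartition.exists_isEpsBalanced_le`), so it loses no energy. Alternating
the two must stop after about 1/ε² rounds, with class counts controlled by p and ε alone. -/

theorem Finpartition.mem_iff_mem_of_mem_atomise {α : Type*} [DecidableEq α] {s : Finset α}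
    {F : Finset (Finset α)} {X C : Finset α} (hX : X ∈ (Finpartition.atomise s F).parts)
    (hC : C ∈ F) {u u' : α} (hu : u ∈ X) (hu' : u' ∈ X) : u ∈ C ↔ u' ∈ C := by
  obtain ⟨-, S, -, rfl⟩ := Finpartition.mem_atomise.1 hX
  rw [mem_filter] at hu hu'
  rw [← hu.2 C hC, hu'.2 C hC]

/-! ### Step densities and the energy increment -/

section StepFunction

theorem sum_adj_eq_card_mul_edgeDensity {V : Type*} (H : SimpleGraph V) [DecidableRel H.Adj]
    (C D : Finset V) :
    ∑ u ∈ C, ∑ v ∈ D, (if H.Adj u v then (1 : ℝ) else 0) =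
      (#C : ℝ) * #D * (H.edgeDensity C D : ℝ) := by
  have h : ∑ u ∈ C, ∑ v ∈ D, (if H.Adj u v then (1 : ℝ) else 0) = (#(H.interedges C D) : ℝ) := by
    rw [← sum_product', SimpleGraph.interedges_def, card_filter]
    push_cast
    rfl
  rw [h, SimpleGraph.edgeDensity_def]
  push_cast
  rcases C.eq_empty_or_nonempty with rfl | hC
  · simp [SimpleGraph.interedges_def]
  rcases D.eq_empty_or_nonempty with rfl | hD
  · simp [SimpleGraph.interedges_def]
  have := hC.card_pos
  have := hD.card_pos
  field_simp

variable {V : Type*} [Fintype V] [DecidableEq V] (H : SimpleGraph V) [DecidableRel H.Adj]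

/-- The density of the cell of `Q × Q` that contains `(u, v)`. -/
noncomputable def stepDensity (Q : Finpartition (univ : Finset V)) (u v : V) : ℝ :=
  (H.edgeDensity (Q.part u) (Q.part v) : ℝ)

/-- The mean square density of a partition, multiplied by `|V| ^ 2`. -/
noncomputable def partitionEnergy (Q : Finpartition (univ : Finset V)) : ℝ :=
  ∑ u, ∑ v, stepDensity H Q u v ^ 2

theorem Finpartition.sum_univ_eq_sum_parts (Q : Finpartition (univ : Finset V)) (f : V → ℝ) :
    ∑ u, f u = ∑ X ∈ Q.parts, ∑ u ∈ X, f u := by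
  conv_lhs => rw [← Q.biUnion_parts]
  exact sum_biUnion Q.disjoint

theorem Finpartition.sum_univ_univ_eq_sum_parts (Q : Finpartition (univ : Finset V))
    (f : V → V → ℝ) :
    ∑ u, ∑ v, f u v = ∑ X ∈ Q.parts, ∑ Y ∈ Q.parts, ∑ u ∈ X, ∑ v ∈ Y, f u v := by
  rw [Q.sum_univ_eq_sum_parts]
  refine sum_congr rfl fun X _ => ?_
  rw [sum_comm (s := Q.parts)]
  exact sum_congr rfl fun u _ => Q.sum_univ_eq_sum_parts _

variable {H} in
theorem stepDensity_eq_of_mem {Q : Finpartition (univ : Finset V)} {A B : Finset V}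
    (hA : A ∈ Q.parts) (hB : B ∈ Q.parts) {u v : V} (hu : u ∈ A) (hv : v ∈ B) :
    stepDensity H Q u v = (H.edgeDensity A B : ℝ) := by
  rw [stepDensity, Q.part_eq_of_mem hA hu, Q.part_eq_of_mem hB hv]

/-- Averaging over the cells of `Q × Q` does not change the correlation with a function that is
constant on these cells. -/
theorem sum_stepDensity_mul (Q : Finpartition (univ : Finset V)) (F : V → V → ℝ)
    (hF : ∀ u u' v v', Q.part u = Q.part u' → Q.part v = Q.part v' → F u v = F u' v') :
    ∑ u, ∑ v, stepDensity H Q u v * F u v =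
      ∑ u, ∑ v, (if H.Adj u v then (1 : ℝ) else 0) * F u v := by
  rw [Q.sum_univ_univ_eq_sum_parts, Q.sum_univ_univ_eq_sum_parts]
  refine sum_congr rfl fun X hX => sum_congr rfl fun Y hY => ?_
  obtain ⟨x, hx⟩ := Q.nonempty_of_mem_parts hX
  obtain ⟨y, hy⟩ := Q.nonempty_of_mem_parts hY
  have hc : ∀ u ∈ X, ∀ v ∈ Y, F u v = F x y := fun u hu v hv =>
    hF u x v y (by rw [Q.part_eq_of_mem hX hu, Q.part_eq_of_mem hX hx])
      (by rw [Q.part_eq_of_mem hY hv, Q.part_eq_of_mem hY hy])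
  have hl : ∑ u ∈ X, ∑ v ∈ Y, stepDensity H Q u v * F u v =
      ∑ u ∈ X, ∑ v ∈ Y, (H.edgeDensity X Y : ℝ) * F x y :=
    sum_congr rfl fun u hu => sum_congr rfl fun v hv => by
      rw [stepDensity_eq_of_mem hX hY hu hv, hc u hu v hv]
  have hr : ∑ u ∈ X, ∑ v ∈ Y, (if H.Adj u v then (1 : ℝ) else 0) * F u v =
      (∑ u ∈ X, ∑ v ∈ Y, (if H.Adj u v then (1 : ℝ) else 0)) * F x y := by
    rw [sum_mul]
    refine sum_congr rfl fun u hu => ?_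
    rw [sum_mul]
    exact sum_congr rfl fun v hv => by rw [hc u hu v hv]
  rw [hl, hr, sum_adj_eq_card_mul_edgeDensity]
  simp only [sum_const, nsmul_eq_mul]
  ring

theorem sum_stepDensity_eq_card_mul_edgeDensity (Q : Finpartition (univ : Finset V))
    {C D : Finset V} (hC : ∀ u u', Q.part u = Q.part u' → (u ∈ C ↔ u' ∈ C))
    (hD : ∀ u u', Q.part u = Q.part u' → (u ∈ D ↔ u' ∈ D)) :
    ∑ u ∈ C, ∑ v ∈ D, stepDensity H Q u v = (#C : ℝ) * #D * (H.edgeDensity C D : ℝ) := by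
  have key := sum_stepDensity_mul H Q (fun u v => if u ∈ C then if v ∈ D then 1 else 0 else 0)
    (fun u u' v v' hu hv => by simp only [hC u u' hu, hD v v' hv])
  have conv : ∀ f : V → V → ℝ,
      ∑ u, ∑ v, f u v * (if u ∈ C then if v ∈ D then 1 else 0 else 0) =
        ∑ u ∈ C, ∑ v ∈ D, f u v := by
    intro f
    simp
  rw [conv, conv, sum_adj_eq_card_mul_edgeDensity] at key
  exact key

theorem Finpartition.part_eq_part_of_le {Q Q' : Finpartition (univ : Finset V)} (h : Q' ≤ Q)
    {u v : V} (huv : Q'.part u = Q'.part v) : Q.part u = Q.part v := by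
  obtain ⟨B, hB, hle⟩ := h (Q'.part_mem.2 (mem_univ u))
  rw [Q.part_eq_of_mem hB (hle (Q'.mem_part_self.2 (mem_univ u))),
    Q.part_eq_of_mem hB (hle (huv ▸ Q'.mem_part_self.2 (mem_univ v)))]

/-- Pythagoras: the coarse step function is the orthogonal projection of the fine one, because both
correlate equally with functions constant on the coarse cells. -/
theorem sum_sq_stepDensity_sub {Q Q' : Finpartition (univ : Finset V)} (h : Q' ≤ Q) :
    ∑ u, ∑ v, (stepDensity H Q' u v - stepDensity H Q u v) ^ 2 =
      partitionEnergy H Q' - partitionEnergy H Q := by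
  have hconst : ∀ u u' v v', Q.part u = Q.part u' → Q.part v = Q.part v' →
      stepDensity H Q u v = stepDensity H Q u' v' := fun u u' v v' hu hv => by
    rw [stepDensity, stepDensity, hu, hv]
  have h1 := sum_stepDensity_mul H Q (stepDensity H Q) hconst
  have h2 := sum_stepDensity_mul H Q' (stepDensity H Q) fun u u' v v' hu hv =>
    hconst u u' v v' (Finpartition.part_eq_part_of_le h hu) (Finpartition.part_eq_part_of_le h hv)
  have h3 := h2.trans h1.symm
  have h4 : ∑ u, ∑ v, (stepDensity H Q' u v - stepDensity H Q u v) ^ 2 =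
      ∑ u, ∑ v, stepDensity H Q' u v ^ 2 - 2 * ∑ u, ∑ v, stepDensity H Q' u v * stepDensity H Q u v
        + ∑ u, ∑ v, stepDensity H Q u v ^ 2 := by
    simp only [mul_sum, ← sum_sub_distrib, ← sum_add_distrib]
    exact sum_congr rfl fun u _ => sum_congr rfl fun v _ => by ring
  rw [h4, h3, partitionEnergy, partitionEnergy]
  simp only [← sq]
  ring

theorem partitionEnergy_mono {Q Q' : Finpartition (univ : Finset V)} (h : Q' ≤ Q) :
    partitionEnergy H Q ≤ partitionEnergy H Q' := by
  rw [← sub_nonneg, ← sum_sq_stepDensity_sub H h]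
  positivity

theorem partitionEnergy_nonneg (Q : Finpartition (univ : Finset V)) : 0 ≤ partitionEnergy H Q := by
  unfold partitionEnergy
  positivity

theorem partitionEnergy_le (Q : Finpartition (univ : Finset V)) :
    partitionEnergy H Q ≤ (Fintype.card V : ℝ) ^ 2 := by
  have h : partitionEnergy H Q ≤ ∑ _u : V, ∑ _v : V, (1 : ℝ) := by
    refine sum_le_sum fun u _ => sum_le_sum fun v _ => ?_
    have h0 : (0 : ℝ) ≤ stepDensity H Q u v := by
      unfold stepDensity
      exact_mod_cast H.edgeDensity_nonneg _ _
    have h1 : stepDensity H Q u v ≤ 1 := by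
      unfold stepDensity
      exact_mod_cast H.edgeDensity_le_one _ _
    exact pow_le_one₀ h0 h1
  simpa [sq] using h

theorem Finpartition.exists_le_atomising (Q : Finpartition (univ : Finset V))
    (F : Finset (Finset V)) :
    ∃ Q' ≤ Q, #Q'.parts ≤ #Q.parts * 2 ^ #F ∧
      ∀ C ∈ F, ∀ u u', Q'.part u = Q'.part u' → (u ∈ C ↔ u' ∈ C) := by
  refine ⟨Q ⊓ Finpartition.atomise univ F, inf_le_left, ?_, fun C hC u u' huu' => ?_⟩
  · rw [Finpartition.parts_inf]
    refine (card_le_card (erase_subset _ _)).trans (card_image_le.trans ?_)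
    rw [card_product]
    exact Nat.mul_le_mul_left _ Finpartition.card_atomise_le
  · have h := Finpartition.part_eq_part_of_le inf_le_right huu'
    set R := Finpartition.atomise univ F
    exact Finpartition.mem_iff_mem_of_mem_atomise (R.part_mem.2 (mem_univ u)) hC
      (R.mem_part_self.2 (mem_univ u)) (h ▸ R.mem_part_self.2 (mem_univ u'))

/-- On the refined partition the sets C, D are unions of classes, so each deviation is at most the
L¹ norm on A × B of the change in step density. Cauchy–Schwarz then passes to the L² norm, which is
the energy gain. -/
theorem exists_partitionEnergy_increment (Q : Finpartition (univ : Finset V)) :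
    ∃ Q' ≤ Q, #Q'.parts ≤ #Q.parts * 2 ^ (2 * #Q.parts ^ 2) ∧
      (∑ A ∈ Q.parts, ∑ B ∈ Q.parts, maxDeviation H A B) ^ 2 ≤
        (Fintype.card V : ℝ) ^ 2 * (partitionEnergy H Q' - partitionEnergy H Q) := by
  choose! C D hwit using fun (A B : Finset V) (hA : A.Nonempty) (hB : B.Nonempty) =>
    (isGreatest_maxDeviation H hA hB).1
  set F := (Q.parts ×ˢ Q.parts).image (fun p => C p.1 p.2) ∪
    (Q.parts ×ˢ Q.parts).image (fun p => D p.1 p.2)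
  have hFcard : #F ≤ 2 * #Q.parts ^ 2 := by
    refine (card_union_le _ _).trans ?_
    rw [two_mul, sq, ← card_product]
    exact add_le_add card_image_le card_image_le
  obtain ⟨Q', hle, hcard, hsat⟩ := Q.exists_le_atomising F
  refine ⟨Q', hle, hcard.trans (by gcongr; norm_num), ?_⟩
  set g : V → V → ℝ := fun u v => stepDensity H Q' u v - stepDensity H Q u v
  have hcell : ∀ A ∈ Q.parts, ∀ B ∈ Q.parts,
      maxDeviation H A B ≤ ∑ u ∈ A, ∑ v ∈ B, |g u v| := by
    intro A hA B hB
    obtain ⟨-, hCA, -, hDB, heq⟩ :=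
      hwit A B (Q.nonempty_of_mem_parts hA) (Q.nonempty_of_mem_parts hB)
    have hCF : C A B ∈ F := mem_union_left _ (mem_image.2 ⟨(A, B), by simp [hA, hB], rfl⟩)
    have hDF : D A B ∈ F := mem_union_right _ (mem_image.2 ⟨(A, B), by simp [hA, hB], rfl⟩)
    have h1 := sum_stepDensity_eq_card_mul_edgeDensity H Q' (hsat _ hCF) (hsat _ hDF)
    have h2 : ∑ u ∈ C A B, ∑ v ∈ D A B, stepDensity H Q u v =
        (#(C A B) : ℝ) * #(D A B) * (H.edgeDensity A B : ℝ) := by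
      rw [sum_congr rfl fun u hu => sum_congr rfl fun v hv =>
        stepDensity_eq_of_mem hA hB (hCA hu) (hDB hv)]
      simp only [sum_const, nsmul_eq_mul]
      ring
    have h3 : ∑ u ∈ C A B, ∑ v ∈ D A B, g u v = (#(C A B) : ℝ) * #(D A B) *
        ((H.edgeDensity (C A B) (D A B) : ℝ) - (H.edgeDensity A B : ℝ)) := by
      simp only [g, sum_sub_distrib]
      rw [h1, h2]
      ring
    calc maxDeviation H A B = |∑ u ∈ C A B, ∑ v ∈ D A B, g u v| := by
          rw [heq, densityDeviation, h3, abs_mul,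
            abs_of_nonneg (by positivity : (0 : ℝ) ≤ (#(C A B) : ℝ) * #(D A B))]
      _ ≤ ∑ u ∈ C A B, ∑ v ∈ D A B, |g u v| :=
          (abs_sum_le_sum_abs _ _).trans (sum_le_sum fun u _ => abs_sum_le_sum_abs _ _)
      _ ≤ ∑ u ∈ A, ∑ v ∈ B, |g u v| := by
          refine (sum_le_sum fun u _ => sum_le_sum_of_subset_of_nonneg hDB
            fun v _ _ => abs_nonneg _).trans ?_
          exact sum_le_sum_of_subset_of_nonneg hCA fun u _ _ => sum_nonneg fun v _ => abs_nonneg _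
  have hnonneg : 0 ≤ ∑ A ∈ Q.parts, ∑ B ∈ Q.parts, maxDeviation H A B := by
    refine sum_nonneg fun A hA => sum_nonneg fun B hB => ?_
    obtain ⟨-, -, -, -, heq⟩ :=
      hwit A B (Q.nonempty_of_mem_parts hA) (Q.nonempty_of_mem_parts hB)
    rw [heq, densityDeviation]
    positivity
  have hsum : ∑ A ∈ Q.parts, ∑ B ∈ Q.parts, maxDeviation H A B ≤ ∑ p : V × V, |g p.1 p.2| := by
    rw [Fintype.sum_prod_type, Q.sum_univ_univ_eq_sum_parts fun u v => |g u v|]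
    exact sum_le_sum fun A hA => sum_le_sum fun B hB => hcell A hA B hB
  calc (∑ A ∈ Q.parts, ∑ B ∈ Q.parts, maxDeviation H A B) ^ 2
      ≤ (∑ p : V × V, |g p.1 p.2|) ^ 2 := pow_le_pow_left₀ hnonneg hsum 2
    _ ≤ #(univ : Finset (V × V)) * ∑ p : V × V, |g p.1 p.2| ^ 2 := sq_sum_le_card_mul_sum_sq
    _ = (Fintype.card V : ℝ) ^ 2 * (partitionEnergy H Q' - partitionEnergy H Q) := by
      rw [← sum_sq_stepDensity_sub H hle, Fintype.sum_prod_type]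
      simp [g, sq]

end StepFunction

/-! ### Cutting classes into equal pieces -/

section Balancing

/-- Cutting a finite set into pieces of size `t` and a remainder of size less than `t`. -/
theorem Finset.exists_finpartition_card_eq {V : Type*} [DecidableEq V] {t : ℕ} (ht : 0 < t)
    (A : Finset V) :
    ∃ R : Finpartition A, ∑ B ∈ R.parts with #B ≠ t, #B < t ∧ #R.parts * t ≤ #A + t := by
  induction A using Finset.strongInduction with
  | H A ih =>
  by_cases hA : #A < t
  · rcases A.eq_empty_or_nonempty with rfl | hne
    · exact ⟨Finpartition.empty _, by simpa using ht, by simp⟩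
    · refine ⟨Finpartition.indiscrete hne.ne_empty, ?_, by simp⟩
      simp [Finset.filter_singleton, hA.ne, hA]
  · obtain ⟨B, hBA, hB⟩ := exists_subset_card_eq (not_lt.1 hA)
    have hBne : B ≠ ∅ := by
      rintro rfl
      simp at hB
      omega
    obtain ⟨R, hR, hRt⟩ := ih (A \ B) (sdiff_ssubset hBA (nonempty_iff_ne_empty.2 hBne))
    refine ⟨R.extend hBne sdiff_disjoint (sdiff_union_of_subset hBA), ?_, ?_⟩
    · rw [Finpartition.extend_parts, filter_insert, if_neg (by simpa using hB)]
      exact hR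
    · rw [Finpartition.card_extend]
      have := card_sdiff_add_card_eq_card hBA
      rw [add_mul]
      omega

theorem Finpartition.exists_isEpsBalanced_le {V : Type*} [Fintype V] [DecidableEq V] [Nonempty V]
    {ε : ℝ} (hε : 0 < ε) {k : ℕ} (P : Finpartition (univ : Finset V)) (hP : #P.parts ≤ k) :
    ∃ Q ≤ P, IsEpsBalanced ε Q ∧ #Q.parts ≤ ⌊2 * k / ε⌋₊ + k := by
  have hk : 0 < k := (card_pos.2 (P.parts_nonempty univ_nonempty.ne_empty)).trans_le hP
  set x : ℝ := ε * Fintype.card V / k with hx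
  have hkR : (0 : ℝ) < k := by exact_mod_cast hk
  have hx0 : 0 ≤ x := by positivity
  -- If x < 1 the pieces are singletons and nothing is left over; this is why the remainder of a
  -- class is bounded by t - 1 rather than t.
  set t : ℕ := max 1 ⌊x⌋₊ with ht
  have ht1 : 1 ≤ t := le_max_left _ _
  choose R hR hRt using Finset.exists_finpartition_card_eq (V := V) ht1
  have hsmall : (k * (t - 1) : ℕ) ≤ ε * Fintype.card V := by
    rcases le_total ⌊x⌋₊ 1 with h | h
    · rw [ht, max_eq_left h]
      simp
      positivity
    · have : (t : ℝ) ≤ x := by rw [ht, max_eq_right h]; exact Nat.floor_le hx0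
      calc ((k * (t - 1) : ℕ) : ℝ) ≤ (k * t : ℕ) := by
            exact_mod_cast Nat.mul_le_mul_left _ (Nat.sub_le _ _)
        _ = k * t := by push_cast; rfl
        _ ≤ k * x := by gcongr
        _ = ε * Fintype.card V := by rw [hx]; field_simp
  -- Rounding down at most halves x, whence the factor 2 in the bound on the number of classes.
  have hxt : x ≤ 2 * t := by
    have h1 := Nat.lt_floor_add_one x
    have h2 : (⌊x⌋₊ : ℝ) ≤ t := by exact_mod_cast le_max_right _ _
    have h3 : (1 : ℝ) ≤ t := by exact_mod_cast ht1
    linarith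
  refine ⟨P.bind fun A _ => R A, ?_, ⟨{B ∈ (P.bind fun A _ => R A).parts | #B ≠ t},
    filter_subset _ _, ?_, ?_⟩, ?_⟩
  · intro B hB
    obtain ⟨A, hA, hBA⟩ := Finpartition.mem_bind.1 hB
    exact ⟨A, hA, (R A).le hBA⟩
  · intro A hA B hB
    simp only [mem_sdiff, mem_filter, not_and, not_not] at hA hB
    rw [hA.2 hA.1, hB.2 hB.1]
  · refine le_trans ?_ hsmall
    have hsub : ({B ∈ (P.bind fun A _ => R A).parts | #B ≠ t}).biUnion id ⊆
        P.parts.biUnion fun A => ({B ∈ (R A).parts | #B ≠ t}).biUnion id := by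
      intro v hv
      simp only [mem_biUnion, mem_filter, Finpartition.mem_bind, id] at hv ⊢
      obtain ⟨B, ⟨⟨A, hA, hBA⟩, hBt⟩, hvB⟩ := hv
      exact ⟨A, hA, B, ⟨hBA, hBt⟩, hvB⟩
    have : #(({B ∈ (P.bind fun A _ => R A).parts | #B ≠ t}).biUnion id) ≤ k * (t - 1) := by
      refine (card_le_card hsub).trans ((card_biUnion_le_card_mul _ _ (t - 1) ?_).trans
        (Nat.mul_le_mul_right _ hP))
      intro A _
      exact card_biUnion_le.trans (Nat.le_sub_one_of_lt (hR A))
    exact_mod_cast this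
  · have hcount : #(P.bind fun A _ => R A).parts * t ≤ Fintype.card V + k * t := by
      rw [Finpartition.card_bind, sum_attach P.parts fun A => #(R A).parts, sum_mul]
      refine (sum_le_sum fun A _ => hRt A).trans ?_
      rw [sum_add_distrib, P.sum_card_parts, sum_const, smul_eq_mul, card_univ]
      exact Nat.add_le_add_left (Nat.mul_le_mul_right _ hP) _
    have htR : (0 : ℝ) < t := by exact_mod_cast ht1
    have hcard : (Fintype.card V : ℝ) ≤ 2 * k / ε * t := by
      rw [hx, div_le_iff₀ hkR] at hxt
      rw [div_mul_eq_mul_div, le_div_iff₀ hε]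
      linarith
    rw [← Nat.floor_add_natCast (by positivity)]
    refine Nat.le_floor (le_of_mul_le_mul_right ?_ htR)
    have : (#(P.bind fun A _ => R A).parts : ℝ) * t ≤ Fintype.card V + k * t := by
      exact_mod_cast hcount
    linarith

end Balancing

-- Iteration

universe u in
-- Here m counts the rounds still affordable: each failed round shrinks the energy gap by (ε|V|)²,
-- and for m = 0 the gap would be negative.
theorem exists_regular_refinement_of_energy_gap {ε : ℝ} (hε : 0 < ε) (m : ℕ) :
    ∀ p : ℕ, ∃ k : ℕ, ∀ (V : Type u) [Fintype V] [DecidableEq V] [Nonempty V]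
      (H : SimpleGraph V) [DecidableRel H.Adj] (P : Finpartition (univ : Finset V)),
      #P.parts ≤ p →
      (Fintype.card V : ℝ) ^ 2 - partitionEnergy H P < m * (ε * Fintype.card V) ^ 2 →
      ∃ Q ≤ P, IsEpsBalanced ε Q ∧ #Q.parts ≤ k ∧
        ∑ A ∈ Q.parts, ∑ B ∈ Q.parts, maxDeviation H A B < ε * (Fintype.card V : ℝ) ^ 2 := by
  induction m with
  | zero =>
    refine fun p => ⟨0, fun V _ _ _ H _ P _ hE => ?_⟩
    have := partitionEnergy_le H P
    simp at hE
    linarith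
  | succ m ih =>
    intro p
    -- The class count after balancing; one increment then raises it to at most b * 2 ^ (2 * b ^ 2).
    set b : ℕ := ⌊2 * p / ε⌋₊ + p
    obtain ⟨k, hk⟩ := ih (b * 2 ^ (2 * b ^ 2))
    refine ⟨max b k, fun V _ _ _ H _ P hP hE => ?_⟩
    obtain ⟨Q, hQP, hbal, hQcard⟩ := P.exists_isEpsBalanced_le hε hP
    by_cases hreg : ∑ A ∈ Q.parts, ∑ B ∈ Q.parts, maxDeviation H A B <
        ε * (Fintype.card V : ℝ) ^ 2
    · exact ⟨Q, hQP, hbal, hQcard.trans (le_max_left _ _), hreg⟩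
    obtain ⟨Q', hQ'Q, hQ'card, hinc⟩ := exists_partitionEnergy_increment H Q
    have hn : (0 : ℝ) < (Fintype.card V : ℝ) ^ 2 := by
      have : 0 < Fintype.card V := Fintype.card_pos
      positivity
    have hgain : (ε * Fintype.card V) ^ 2 ≤ partitionEnergy H Q' - partitionEnergy H Q := by
      refine le_of_mul_le_mul_left (le_trans ?_ hinc) hn
      calc (Fintype.card V : ℝ) ^ 2 * (ε * Fintype.card V) ^ 2
          = (ε * (Fintype.card V : ℝ) ^ 2) ^ 2 := by ring
        _ ≤ _ := pow_le_pow_left₀ (by positivity) (not_lt.1 hreg) 2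
    have hmono := partitionEnergy_mono H hQP
    obtain ⟨S, hSQ', hSbal, hScard, hSreg⟩ := hk V H Q'
      (hQ'card.trans (by gcongr; norm_num)) (by
        push_cast at hE
        linarith)
    exact ⟨S, hSQ'.trans (hQ'Q.trans hQP), hSbal, hScard.trans (le_max_right _ _), hSreg⟩

theorem mainTheorem2 (ε : ℝ) (hε : 0 < ε) (p : ℕ) :
    ∃ k : ℕ, ∀ (V : Type*) [Fintype V] [DecidableEq V] [Nonempty V]
      (H : SimpleGraph V) [DecidableRel H.Adj]
      (P : Finpartition (Finset.univ : Finset V)), P.parts.card = p →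
      ∃ Q : Finpartition (Finset.univ : Finset V),
        Q ≤ P ∧ IsEpsBalanced ε Q ∧ Q.parts.card ≤ k ∧
        ∑ A ∈ Q.parts, ∑ B ∈ Q.parts, maxDeviation H A B < ε * (Fintype.card V : ℝ) ^ 2 := by
  -- The initial gap is at most |V|², which is less than m(ε|V|)².
  obtain ⟨m, hm⟩ := exists_nat_gt (1 / ε ^ 2)
  obtain ⟨k, hk⟩ := exists_regular_refinement_of_energy_gap hε m p
  refine ⟨k, fun V _ _ _ H _ P hP => hk V H P hP.le ?_⟩
  have hn : (0 : ℝ) < (Fintype.card V : ℝ) ^ 2 := by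
    have : 0 < Fintype.card V := Fintype.card_pos
    positivity
  rw [div_lt_iff₀ (by positivity)] at hm
  have := partitionEnergy_nonneg H P
  nlinarith
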